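/- The infinite king grid $K$ is the graph with vertex set $\mathbb{Z}^2$ in which two distinct points are adjacent if and only if they differ by at most $1$ in each coordinate; $N(v)$ and $N[v]=N(v)\cup\{v\}$ denote the open and closed neighborhoods of $v$. A set $S\subseteq V(K)$ of detectors monitors $K$ for an intruder, which is absent or located at one vertex: a detector $d\in S$ correctly transmits $2$ if the intruder is at $d$, $1$ if it is in $N(d)$, and $0$ otherwise. The set $S$ is an ERR:LD (error-correcting locating-dominating) set if, whenever at most one detector transmits an incorrect value in $\{0,1,2\}$, the transmitted values still determine whether there is an intruder and, if so, at which vertex. For $v\in V(K)$ let $\mathrm{dom}(v)=|\{u\in S: v\in N[u]\}|$, and let the share of a detector $x\in S$ be $$\mathrm{sh}(x)=\sum_{u\in N[x]}\frac{1}{\mathrm{dom}(u)}.$$ **Theorem.** Let $S$ be an ERR:LD set for the infinite king grid. Then the average share of all vertices in $S$ is at most $\frac{38}{15}$. That is, for every $c\in\mathbb{Z}^2$, with $Q_n(c)$ denoting the set of points that differ from $c$ by at most $n$ in each coordinate, $$\limsup_{n\to\infty}\ \frac{1}{|S\cap Q_n(c)|}\sum_{x\in S\cap Q_n(c)}\mathrm{sh}(x)\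 \le\ \frac{38}{15}.$$ -/

import Mathlib

noncomputable section

/-- The infinite king grid: the vertices are the points of `ℤ × ℤ`, and two distinct points are
adjacent when they differ by at most one in each coordinate. -/
def kingGrid : SimpleGraph (ℤ × ℤ) where
  Adj p q := p ≠ q ∧ |p.1 - q.1| ≤ 1 ∧ |p.2 - q.2| ≤ 1
  symm := ⟨fun p q h => ⟨h.1.symm, by rw [abs_sub_comm]; exact h.2.1, by
    rw [abs_sub_comm]; exact h.2.2⟩⟩
  loopless := ⟨fun _ h => h.1 rfl⟩

namespace LocatingDomination

variable {V : Type*}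

/-- The closed neighborhood `N[v] = N(v) ∪ {v}`. -/
def closedNbhd (G : SimpleGraph V) (v : V) : Set V :=
  insert v (G.neighborSet v)

open Classical in
/-- The correct transmission of a locating-dominating detector at `d`. The state `none` means that
there is no intruder, and `some w` that there is an intruder at `w`. The detector sends `2` if the
intruder is at `d`, `1` if it is in the open neighborhood of `d`, and `0` otherwise. -/
def correctSignal (G : SimpleGraph V) : Option V → V → Fin 3
  | none, _ => 0
  | some w, d => if w = d then 2 else if G.Adj d w then 1 else 0

/-- The family `r` of values received from the detectors in `S` can occur in the state `i` when at
most one detector errs, that is, sends a value different from the correct one. -/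
def Receivable (G : SimpleGraph V) (S : Set V) (i : Option V) (r : S → Fin 3) : Prop :=
  {d : S | r d ≠ correctSignal G i d}.Subsingleton

/-- `S` is an error-correcting locating-dominating (ERR:LD) set: even if at most one detector errs,
the received values determine whether there is an intruder, and where it is. -/
def IsERRLD (G : SimpleGraph V) (S : Set V) : Prop :=
  ∀ (i j : Option V) (r : S → Fin 3), Receivable G S i r → Receivable G S j r → i = j

/-- The domination count `dom(v)`: the number of detectors `u ∈ S` with `v ∈ N[u]`. Here and below
the graph is meant to be locally finite. -/
def dom (G : SimpleGraph V) (S : Set V) (v : V) : ℕ :=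
  {u | u ∈ S ∧ v ∈ closedNbhd G u}.ncard

/-- The partial share `sh[v] = 1 / dom(v)`. -/
def partialShare (G : SimpleGraph V) (S : Set V) (v : V) : ℝ :=
  1 / (dom G S v : ℝ)

/-- The share `sh(x)` of a detector `x`: the sum of the partial shares of the vertices that it
dominates. -/
def share (G : SimpleGraph V) (S : Set V) (x : V) : ℝ :=
  ∑ᶠ u ∈ closedNbhd G x, partialShare G S u

open Classical in
/-- The detectors in the `(2 n + 1) × (2 n + 1)` square with center `c`. -/
def detectorsInSquare (S : Set (ℤ × ℤ)) (c : ℤ × ℤ) (n : ℕ) : Finset (ℤ × ℤ) :=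
  {x ∈ Finset.Icc (c.1 - n) (c.1 + n) ×ˢ Finset.Icc (c.2 - n) (c.2 + n) | x ∈ S}

/-- The average share of the detectors in the `(2 n + 1) × (2 n + 1)` square with center `c`. -/
def squareAverageShare (S : Set (ℤ × ℤ)) (c : ℤ × ℤ) (n : ℕ) : ℝ :=
  (∑ x ∈ detectorsInSquare S c n, share kingGrid S x) / ((detectorsInSquare S c n).card : ℝ)

/-- The (upper) average share of the detectors in `S` on the infinite king grid: the limit superior
of the averages over the squares that grow around `c`, taken in the extended reals. -/
def averageShare (S : Set (ℤ × ℤ)) (c : ℤ × ℤ) : EReal :=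
  Filter.limsup (fun n : ℕ => ((squareAverageShare S c n : ℝ) : EReal)) Filter.atTop

end LocatingDomination

end

/-! A vertex `u` gives `1 / dom(u)` to each of its `dom(u)` detectors, so at most 1 in all. The
shares in `Q_n` thus add up to at most `(2n+3)²`, and the average share is bounded by the inverse
density of detectors. A detector dominates 9 vertices, so a lower bound on the mean of `dom`,
divided by 9, bounds the density.

The local input is `IsERRLD.le_sum_dom_block`: `dom` totals at least 57 on each 4×4 block. The
density is then at least `57 / (16 · 9) = 19/48`, and `48/19 < 38/15` leaves room for boundary
terms.

For the block, tolerating one error forces any two states to be distinguished by three detectors. If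
the total were at most 56, one half of the block would have at most 28, after a reflection the upper
one. All closed neighborhoods of the block lie in a 6×6 window, and an exhaustive search there
(`refute_windowConstraints`) excludes this. -/

namespace LocatingDomination

/-! ### Backtracking search with packed slacks -/

/-- A linear constraint on a 0-1 assignment: the losses incurred by the values of the cells
may not add up to more than the slack. -/
structure SlackConstraint (α : Type*) where
  /-- the total loss that is allowed -/
  slack : ℕ
  /-- the loss incurred when a cell receives a value -/
  loss : α → Bool → ℕ

/-- The numbers `v c`, for `c` in a list of constraints, as the digits of a number in base `256`. -/
def packDigits {γ : Type*} (C : List γ) (v : γ → ℕ) : ℕ :=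
  C.foldr (fun c y => v c + 256 * y) 0

/-- Depth-first search through all 0-1 assignments. An entry of the list holds the packed losses
for the values `false` and `true` of one cell, and `s` the packed remaining slacks, each
increased by `128`. A branch is closed when a slack becomes negative, that is, when a bit of the
mask `M` disappears from `s`. The value is `true` if all branches are closed. -/
def refute (M : ℕ) : List (ℕ × ℕ) → ℕ → Bool
  | [], _ => false
  | a :: L, s =>
    (!Nat.beq (Nat.land (Nat.sub s a.1) M) M || refute M L (Nat.sub s a.1)) &&
    (!Nat.beq (Nat.land (Nat.sub s a.2) M) M || refute M L (Nat.sub s a.2))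

theorem packDigits_add {γ : Type*} (C : List γ) (v w : γ → ℕ) :
    packDigits C (fun c => v c + w c) = packDigits C v + packDigits C w := by
  induction C with
  | nil => rfl
  | cons c C ih => simp only [packDigits, List.foldr_cons] at ih ⊢; rw [ih]; ring

theorem packDigits_congr {γ : Type*} (C : List γ) (v w : γ → ℕ) (h : ∀ c ∈ C, v c = w c) :
    packDigits C v = packDigits C w := by
  induction C with
  | nil => rfl
  | cons c C ih =>
    simp only [packDigits, List.foldr_cons] at ih ⊢
    rw [ih fun d hd => h d (List.mem_cons_of_mem _ hd), h c List.mem_cons_self]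

theorem land_add_base_mul (a b x y : ℕ) (ha : a < 256) (hb : b < 256) :
    (a + 256 * x) &&& (b + 256 * y) = (a &&& b) + 256 * (x &&& y) := by
  have hab : a &&& b < 2 ^ 8 := Nat.and_lt_two_pow _ hb
  have e (c z : ℕ) : c + 256 * z = 2 ^ 8 * z + c := by ring
  rw [e, e, e]
  refine Nat.eq_of_testBit_eq fun i => ?_
  rw [Nat.testBit_and, Nat.testBit_two_pow_mul_add _ (by simpa using ha),
    Nat.testBit_two_pow_mul_add _ (by simpa using hb), Nat.testBit_two_pow_mul_add _ hab]
  split <;> simp [Nat.testBit_and]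

theorem packDigits_land {γ : Type*} (C : List γ) (v : γ → ℕ)
    (h : ∀ c ∈ C, 128 ≤ v c ∧ v c < 256) :
    packDigits C v &&& packDigits C (fun _ => 128) = packDigits C (fun _ => 128) := by
  induction C with
  | nil => simp [packDigits]
  | cons c C ih =>
    have ih := ih fun d hd => h d (List.mem_cons_of_mem _ hd)
    simp only [packDigits, List.foldr_cons] at ih ⊢
    obtain ⟨h1, h2⟩ := h c List.mem_cons_self
    rw [land_add_base_mul _ _ _ _ h2 (by norm_num), ih]
    have key : v c &&& 128 = 128 := by
      have : ∀ n < 256, 128 ≤ n → n &&& 128 = 128 := by decide +kernel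
      exact this _ h2 h1
    rw [key]

/-- The packed losses of all cells. -/
def packedLosses {α : Type*} (C : List (SlackConstraint α)) (cells : List α) : List (ℕ × ℕ) :=
  cells.map fun x => (packDigits C (fun c => c.loss x false), packDigits C (fun c => c.loss x true))

/-- Soundness of the search: the branch that follows a feasible `f` is never closed. Borrows between
digits can occur only on infeasible branches, where nothing is claimed. -/
theorem refute_eq_false {α : Type*} (C : List (SlackConstraint α)) (f : α → Bool)
    (cells : List α) (v : SlackConstraint α → ℕ)
    (hv : ∀ c ∈ C, 128 + (cells.map fun x => c.loss x (f x)).sum ≤ v c ∧ v c < 256) :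
    refute (packDigits C fun _ => 128) (packedLosses C cells) (packDigits C v) = false := by
  induction cells generalizing v with
  | nil => rfl
  | cons x cells ih =>
    -- Each digit is at least the loss subtracted from it, so there is no borrow and the subtraction
    -- acts digit by digit.
    have hsub : packDigits C v - packDigits C (fun c => c.loss x (f x)) =
        packDigits C (fun c => v c - c.loss x (f x)) := by
      rw [Nat.sub_eq_iff_eq_add', ← packDigits_add]
      · refine packDigits_congr _ _ _ fun c hc => ?_
        have := hv c hc
        simp only [List.map_cons, List.sum_cons] at this
        omega
      · rw [packDigits_congr C v fun c => c.loss x (f x) + (v c - c.loss x (f x)), packDigits_add]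
        · exact Nat.le_add_right _ _
        · intro c hc
          have := hv c hc
          simp only [List.map_cons, List.sum_cons] at this
          omega
    have hv' : ∀ c ∈ C, 128 + (cells.map fun x => c.loss x (f x)).sum ≤ v c - c.loss x (f x) ∧
        v c - c.loss x (f x) < 256 := by
      intro c hc
      have := hv c hc
      simp only [List.map_cons, List.sum_cons] at this
      omega
    have hr := ih _ hv'
    have hl := packDigits_land C (fun c => v c - c.loss x (f x)) fun c hc => by
      have := hv' c hc
      omega
    rw [← hsub] at hr hl
    replace hl : Nat.beq (Nat.land (Nat.sub (packDigits C v)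
        (packDigits C (fun c => c.loss x (f x)))) (packDigits C fun _ => 128))
        (packDigits C fun _ => 128) = true := by
      rw [Nat.beq_eq]; exact hl
    change refute _ (packedLosses C cells) (Nat.sub _ _) = false at hr
    cases hf : f x <;> rw [hf] at hr hl <;>
      simp only [packedLosses, List.map_cons, refute] at hr ⊢ <;> rw [hr, hl] <;> simp

/-! ### The finite problem on the 6×6 window -/

/-- Adjacency or equality in the king grid, for points with coordinates in `ℕ`. -/
def near (p q : ℕ × ℕ) : Bool :=
  Nat.ble p.1 (q.1 + 1) && Nat.ble q.1 (p.1 + 1) && Nat.ble p.2 (q.2 + 1) && Nat.ble q.2 (p.2 + 1)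

/-- The points whose detectors distinguish an intruder at `p` from one at `q`. -/
def separates (p q x : ℕ × ℕ) : Bool :=
  (near p x).xor (near q x) || (Nat.beq x.1 p.1 && Nat.beq x.2 p.2) ||
    (Nat.beq x.1 q.1 && Nat.beq x.2 q.2)

/-- The cells of the `6 × 6` window, the first four rows column by column, then the others. -/
def windowCells : List (ℕ × ℕ) :=
  ((List.range 6).flatMap fun j => (List.range 4).map fun i => (i, j)) ++
    (List.range 6).map (fun j => (4, j)) ++ (List.range 6).map (fun j => (5, j))

/-- The upper half of the inner `4 × 4` block of the window. -/
def upperCells : List (ℕ × ℕ) := [(1, 1), (2, 1), (1, 2), (2, 2), (1, 3), (2, 3), (1, 4), (2, 4)]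

/-- The lower half of the inner `4 × 4` block of the window. -/
def lowerCells : List (ℕ × ℕ) := [(3, 1), (3, 2), (3, 3), (3, 4), (4, 1), (4, 2), (4, 3), (4, 4)]

/-- The inner `4 × 4` block of the window. -/
def innerCells : List (ℕ × ℕ) := upperCells ++ lowerCells

/-- At least three cells of `K` have the value `true`. -/
def atLeastThree (K : ℕ × ℕ → Bool) : SlackConstraint (ℕ × ℕ) where
  slack := windowCells.countP K - 3
  loss x b := cond (K x && !b) 1 0

/-- The cells of `D` are dominated at most `u` times altogether. -/
def atMostTotal (D : List (ℕ × ℕ)) (u : ℕ) : SlackConstraint (ℕ × ℕ) where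
  slack := u
  loss x b := cond b (D.countP fun p => near p x) 0

/-- The adjacent pairs of inner cells, each in one order. -/
def adjacentPairs : List ((ℕ × ℕ) × (ℕ × ℕ)) :=
  (innerCells.flatMap fun p => innerCells.map fun q => (p, q)).filter fun e =>
    near e.1 e.2 && Nat.blt (4 * e.1.1 + e.1.2) (4 * e.2.1 + e.2.2)

/-- The constraints on the detectors in the window when the upper half of the inner block is
dominated at most `28` times and the whole block at most `56` times. -/
def windowConstraints : List (SlackConstraint (ℕ × ℕ)) :=
  innerCells.map (fun p => atLeastThree (near p)) ++
  adjacentPairs.map (fun e => atLeastThree (separates e.1 e.2)) ++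
  (List.range 9).map (fun k => atMostTotal (upperCells.take k) (3 * k + 4)) ++
  (List.range 9).map (fun k => atMostTotal (upperCells ++ lowerCells.take k) (3 * k + 32))

/-- The first four rows contain all neighborhoods of the upper half, so its bound prunes before the
last two rows are tried. The bounds on initial segments are implied by the totals and serve to close
branches early. -/
theorem refute_windowConstraints :
    refute (packDigits windowConstraints fun _ => 128) (packedLosses windowConstraints windowCells)
      (packDigits windowConstraints fun c => 128 + c.slack) = true := by
  decide +kernel

theorem countP_and_add_countP_and_not {α : Type*} (K f : α → Bool) (l : List α) :
    l.countP (fun x => K x && f x) + (l.map fun x => cond (K x && !f x) 1 0).sum =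
      l.countP K := by
  induction l with
  | nil => rfl
  | cons x l ih =>
    simp only [List.countP_cons, List.map_cons, List.sum_cons, ← ih]
    cases K x <;> cases f x <;> simp <;> ring

/-- Double counting of the related pairs with `f` true, by cells of `l` and by elements of `D`. -/
theorem sum_cond_countP {α β : Type*} (r : β → α → Bool) (f : α → Bool) (l : List α)
    (D : List β) :
    (l.map fun x => cond (f x) (D.countP fun p => r p x) 0).sum =
      (D.map fun p => l.countP fun x => r p x && f x).sum := by
  induction l with
  | nil => simp
  | cons x l ih =>
    simp only [List.countP_cons, List.map_cons, List.sum_cons, List.sum_map_add, ih]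
    rw [add_comm, Nat.add_left_cancel_iff]
    cases f x <;> simp [List.countP_eq_length_filter, List.sum_map_ite]

/-- Each omitted entry is worth at least 3. This turns the totals 28 and 56 into the bounds `3k + 4`
and `3k + 32` on initial segments. -/
theorem sum_take_map_le {α : Type*} (g : α → ℕ) (L : List α) (h : ∀ p ∈ L, 3 ≤ g p) (k : ℕ)
    (hk : k ≤ L.length) :
    ((L.take k).map g).sum + 3 * L.length ≤ (L.map g).sum + 3 * k := by
  induction L generalizing k with
  | nil => simp
  | cons p L ih =>
    have hp := h p List.mem_cons_self
    have hL := fun q hq => h q (List.mem_cons_of_mem _ hq)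
    cases k with
    | zero =>
      have := ih hL 0 (Nat.zero_le _)
      simp only [List.take_zero, List.map_nil, List.sum_nil, List.map_cons, List.sum_cons,
        List.length_cons] at this ⊢
      omega
    | succ k =>
      have := ih hL k (by simpa using hk)
      simp only [List.take_succ_cons, List.map_cons, List.sum_cons, List.length_cons] at this ⊢
      omega

theorem false_of_window (f : ℕ × ℕ → Bool)
    (h3 : ∀ p ∈ innerCells, 3 ≤ windowCells.countP fun x => near p x && f x)
    (hs : ∀ e ∈ adjacentPairs, 3 ≤ windowCells.countP fun x => separates e.1 e.2 x && f x)
    (hU : (upperCells.map fun p => windowCells.countP fun x => near p x && f x).sum ≤ 28)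
    (hI : (innerCells.map fun p => windowCells.countP fun x => near p x && f x).sum ≤ 56) :
    False := by
  have low (K : ℕ × ℕ → Bool) (hK : 3 ≤ windowCells.countP fun x => K x && f x) :
      (windowCells.map fun x => (atLeastThree K).loss x (f x)).sum ≤ (atLeastThree K).slack := by
    have := countP_and_add_countP_and_not K f windowCells
    simp only [atLeastThree]
    omega
  have high (D : List (ℕ × ℕ)) (u : ℕ)
      (hD : (D.map fun p => windowCells.countP fun x => near p x && f x).sum ≤ u) :
      (windowCells.map fun x => (atMostTotal D u).loss x (f x)).sum ≤ (atMostTotal D u).slack := by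
    simp only [atMostTotal]
    rwa [sum_cond_countP near f windowCells D]
  have hvalid : ∀ c ∈ windowConstraints,
      (windowCells.map fun x => c.loss x (f x)).sum ≤ c.slack := by
    intro c hc
    simp only [windowConstraints, List.mem_append, List.mem_map, List.mem_range] at hc
    rcases hc with ((⟨p, hp, rfl⟩ | ⟨e, he, rfl⟩) | ⟨k, hk, rfl⟩) | ⟨k, hk, rfl⟩
    · exact low _ (h3 p hp)
    · exact low _ (hs e he)
    · refine high _ _ ?_
      have := sum_take_map_le (fun p => windowCells.countP fun x => near p x && f x) upperCells
        (fun p hp => h3 p (List.mem_append_left _ hp)) k (by simp [upperCells]; omega)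
      simp only [show upperCells.length = 8 from rfl] at this
      omega
    · refine high _ _ ?_
      have := sum_take_map_le (fun p => windowCells.countP fun x => near p x && f x) lowerCells
        (fun p hp => h3 p (List.mem_append_right _ hp)) k (by simp [lowerCells]; omega)
      simp only [show lowerCells.length = 8 from rfl] at this
      simp only [innerCells, List.map_append, List.sum_append] at hI ⊢
      omega
  have hslack : ∀ c ∈ windowConstraints, 128 + c.slack < 256 := by
    have : (windowConstraints.all fun c => Nat.blt (128 + c.slack) 256) = true := by
      decide +kernel
    intro c hc
    have := List.all_eq_true.mp this c hc
    simpa [Nat.blt] using this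
  have := refute_eq_false windowConstraints f windowCells (fun c => 128 + c.slack)
    fun c hc => ⟨Nat.add_le_add_left (hvalid c hc) _, hslack c hc⟩
  rw [refute_windowConstraints] at this
  exact Bool.noConfusion this

/-! ### Three detectors distinguish any two states -/

theorem IsERRLD.exists_signal_ne {V : Type*} {G : SimpleGraph V} {S : Set V} (hS : IsERRLD G S)
    {i j : Option V} (hij : i ≠ j) (x y : V) :
    ∃ d ∈ S, d ≠ x ∧ d ≠ y ∧ correctSignal G i d ≠ correctSignal G j d := by
  classical
  by_contra! h
  -- If only `x` and `y` told the states apart, these values would arise from `i` by an error at `x`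
  -- and from `j` by an error at `y`.
  refine hij (hS i j (fun d => if d = x then correctSignal G j d else correctSignal G i d) ?_ ?_)
  · intro d hd e he
    have hx (d : S) (hd : (if (d : V) = x then correctSignal G j d else correctSignal G i d) ≠
        correctSignal G i d) : (d : V) = x := by
      by_contra hne
      exact hd (if_neg hne)
    exact Subtype.ext ((hx d hd).trans (hx e he).symm)
  · intro d hd e he
    have hy (d : S) (hd : (if (d : V) = x then correctSignal G j d else correctSignal G i d) ≠
        correctSignal G j d) : (d : V) = y := by
      by_contra hne
      by_cases hdx : (d : V) = x
      · exact hd (if_pos hdx)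
      · rw [if_neg hdx] at hd
        exact hd (h d d.2 hdx hne)
    exact Subtype.ext ((hy d hd).trans (hy e he).symm)

theorem three_le_length_of_exists_ne {α : Type*} [Nonempty α] (l : List α)
    (h : ∀ x y, ∃ d ∈ l, d ≠ x ∧ d ≠ y) : 3 ≤ l.length := by
  match l with
  | [] => obtain ⟨d, hd, -⟩ := h (Classical.arbitrary α) (Classical.arbitrary α); simp at hd
  | [a] => obtain ⟨d, hd, h1, -⟩ := h a a; simp_all
  | [a, b] => obtain ⟨d, hd, h1, h2⟩ := h a b; simp_all
  | _ :: _ :: _ :: _ => simp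

theorem mem_closedNbhd_kingGrid {u v : ℤ × ℤ} :
    v ∈ closedNbhd kingGrid u ↔ |v.1 - u.1| ≤ 1 ∧ |v.2 - u.2| ≤ 1 := by
  rw [closedNbhd, Set.mem_insert_iff, SimpleGraph.mem_neighborSet]
  simp only [kingGrid]
  constructor
  · rintro (rfl | ⟨-, h1, h2⟩)
    · simp
    · rw [abs_sub_comm, abs_sub_comm v.2]; exact ⟨h1, h2⟩
  · rintro ⟨h1, h2⟩
    by_cases h : v = u
    · exact Or.inl h
    · rw [abs_sub_comm] at h1 h2; exact Or.inr ⟨fun e => h e.symm, h1, h2⟩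

theorem mem_closedNbhd_kingGrid_comm {u v : ℤ × ℤ} :
    v ∈ closedNbhd kingGrid u ↔ u ∈ closedNbhd kingGrid v := by
  rw [mem_closedNbhd_kingGrid, mem_closedNbhd_kingGrid, abs_sub_comm, abs_sub_comm v.2]

theorem mem_closedNbhd_of_correctSignal_ne_none {w d : ℤ × ℤ}
    (h : correctSignal kingGrid none d ≠ correctSignal kingGrid (some w) d) :
    d ∈ closedNbhd kingGrid w := by
  simp only [correctSignal] at h
  split_ifs at h with h1 h2
  · exact h1 ▸ Set.mem_insert _ _
  · exact Set.mem_insert_of_mem _ h2.symm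
  · exact absurd rfl h

theorem separates_of_correctSignal_ne {v w d : ℤ × ℤ}
    (h : correctSignal kingGrid (some v) d ≠ correctSignal kingGrid (some w) d) :
    d = v ∨ d = w ∨ ¬(d ∈ closedNbhd kingGrid v ↔ d ∈ closedNbhd kingGrid w) := by
  by_contra! hn
  obtain ⟨h1, h2, h3⟩ := hn
  apply h
  simp only [closedNbhd, Set.mem_insert_iff, h1, h2, false_or, SimpleGraph.mem_neighborSet] at h3
  rw [SimpleGraph.adj_comm, SimpleGraph.adj_comm _ w] at h3
  by_cases hw : kingGrid.Adj d w
  · simp [correctSignal, Ne.symm h1, Ne.symm h2, h3.2 hw, hw]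
  · simp [correctSignal, Ne.symm h1, Ne.symm h2, mt h3.1 hw, hw]

/-! ### Windows in the king grid and the block bound -/

/-- An embedding of the window into the king grid. -/
structure IsWindowMap (φ : ℕ × ℕ → ℤ × ℤ) : Prop where
  injOn : ∀ x ∈ windowCells, ∀ y ∈ windowCells, φ x = φ y → x = y
  near_iff : ∀ x ∈ windowCells, ∀ y ∈ windowCells,
    near x y = true ↔ φ y ∈ closedNbhd kingGrid (φ x)
  exists_of_mem : ∀ p ∈ innerCells, ∀ d ∈ closedNbhd kingGrid (φ p), ∃ x ∈ windowCells, φ x = d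

theorem nodup_windowCells : windowCells.Nodup := by decide

theorem mem_windowCells_iff {i j : ℕ} : (i, j) ∈ windowCells ↔ i < 6 ∧ j < 6 := by
  simp [windowCells]
  omega

theorem innerCells_subset_windowCells : innerCells ⊆ windowCells := by decide

theorem mem_innerCells {i j : ℕ} (h : (i, j) ∈ innerCells) :
    1 ≤ i ∧ i ≤ 4 ∧ 1 ≤ j ∧ j ≤ 4 := by
  have : ∀ p ∈ innerCells, 1 ≤ p.1 ∧ p.1 ≤ 4 ∧ 1 ≤ p.2 ∧ p.2 ≤ 4 := by decide
  exact this _ h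

open Classical in
theorem IsWindowMap.countP_near {φ : ℕ × ℕ → ℤ × ℤ} (hφ : IsWindowMap φ) (S : Set (ℤ × ℤ))
    {p : ℕ × ℕ} (hp : p ∈ innerCells) :
    windowCells.countP (fun x => near p x && decide (φ x ∈ S)) = dom kingGrid S (φ p) := by
  have hset : {u | u ∈ S ∧ φ p ∈ closedNbhd kingGrid u} =
      (((windowCells.filter fun x => near p x && decide (φ x ∈ S)).map φ).toFinset :
        Set (ℤ × ℤ)) := by
    ext u
    simp only [Set.mem_ofPred_eq, List.coe_toFinset, List.mem_map, List.mem_filter,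
      Bool.and_eq_true, decide_eq_true_eq]
    constructor
    · rintro ⟨hu, hpu⟩
      rw [mem_closedNbhd_kingGrid_comm] at hpu
      obtain ⟨x, hx, rfl⟩ := hφ.exists_of_mem p hp u hpu
      exact ⟨x, ⟨hx, (hφ.near_iff _ (innerCells_subset_windowCells hp) _ hx).2 hpu, hu⟩, rfl⟩
    · rintro ⟨x, ⟨hx, hn, hS⟩, rfl⟩
      rw [mem_closedNbhd_kingGrid_comm]
      exact ⟨hS, (hφ.near_iff _ (innerCells_subset_windowCells hp) _ hx).1 hn⟩
  rw [dom, hset, Set.ncard_coe_finset, List.toFinset_card_of_nodup, List.length_map,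
    List.countP_eq_length_filter]
  refine List.Nodup.map_on ?_ (nodup_windowCells.filter _)
  intro x hx y hy
  exact hφ.injOn x (List.mem_of_mem_filter hx) y (List.mem_of_mem_filter hy)

open Classical in
theorem IsWindowMap.three_le_countP_near {φ : ℕ × ℕ → ℤ × ℤ} (hφ : IsWindowMap φ)
    {S : Set (ℤ × ℤ)} (hS : IsERRLD kingGrid S) {p : ℕ × ℕ} (hp : p ∈ innerCells) :
    3 ≤ windowCells.countP fun x => near p x && decide (φ x ∈ S) := by
  rw [List.countP_eq_length_filter, ← List.length_map φ]
  refine three_le_length_of_exists_ne _ fun u v => ?_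
  obtain ⟨d, hd, hu, hv, hne⟩ := hS.exists_signal_ne (Option.some_ne_none (φ p)).symm u v
  have hmem := mem_closedNbhd_of_correctSignal_ne_none hne
  obtain ⟨x, hx, rfl⟩ := hφ.exists_of_mem p hp d hmem
  refine ⟨φ x, List.mem_map_of_mem (List.mem_filter.2 ⟨hx, ?_⟩), hu, hv⟩
  simp [(hφ.near_iff _ (innerCells_subset_windowCells hp) _ hx).2 hmem, hd]

theorem mem_of_mem_adjacentPairs {e : (ℕ × ℕ) × (ℕ × ℕ)} (he : e ∈ adjacentPairs) :
    e.1 ∈ innerCells ∧ e.2 ∈ innerCells ∧ e.1 ≠ e.2 := by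
  have : ∀ e ∈ adjacentPairs, e.1 ∈ innerCells ∧ e.2 ∈ innerCells ∧ e.1 ≠ e.2 := by
    decide +kernel
  exact this e he

open Classical in
theorem IsWindowMap.three_le_countP_separates {φ : ℕ × ℕ → ℤ × ℤ} (hφ : IsWindowMap φ)
    {S : Set (ℤ × ℤ)} (hS : IsERRLD kingGrid S) {e : (ℕ × ℕ) × (ℕ × ℕ)}
    (he : e ∈ adjacentPairs) :
    3 ≤ windowCells.countP fun x => separates e.1 e.2 x && decide (φ x ∈ S) := by
  obtain ⟨h1, h2, h12⟩ := mem_of_mem_adjacentPairs he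
  have w1 := innerCells_subset_windowCells h1
  have w2 := innerCells_subset_windowCells h2
  rw [List.countP_eq_length_filter, ← List.length_map φ]
  refine three_le_length_of_exists_ne _ fun u v => ?_
  have hne : (some (φ e.1) : Option (ℤ × ℤ)) ≠ some (φ e.2) := fun h =>
    h12 (hφ.injOn _ w1 _ w2 (Option.some.inj h))
  obtain ⟨d, hd, hu, hv, hsig⟩ := hS.exists_signal_ne hne u v
  have hsep := separates_of_correctSignal_ne hsig
  have hx : ∃ x ∈ windowCells, φ x = d := by
    rcases hsep with rfl | rfl | h
    · exact ⟨_, w1, rfl⟩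
    · exact ⟨_, w2, rfl⟩
    · by_cases hm : d ∈ closedNbhd kingGrid (φ e.1)
      · exact hφ.exists_of_mem _ h1 d hm
      · refine hφ.exists_of_mem _ h2 d ?_
        by_contra hc
        exact h (iff_of_false hm hc)
  obtain ⟨x, hx, rfl⟩ := hx
  refine ⟨φ x, List.mem_map_of_mem (List.mem_filter.2 ⟨hx, ?_⟩), hu, hv⟩
  rw [Bool.and_eq_true, decide_eq_true_eq]
  refine ⟨?_, hd⟩
  rw [← hφ.near_iff _ w1 _ hx, ← hφ.near_iff _ w2 _ hx] at hsep
  rcases hsep with h | h | h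
  · rw [hφ.injOn _ hx _ w1 h]; simp [separates]
  · rw [hφ.injOn _ hx _ w2 h]; simp [separates]
  · cases ha : near e.1 x <;> cases hb : near e.2 x <;> simp_all [separates]

theorem IsWindowMap.block_bound {φ : ℕ × ℕ → ℤ × ℤ} (hφ : IsWindowMap φ)
    {S : Set (ℤ × ℤ)} (hS : IsERRLD kingGrid S)
    (hU : (upperCells.map fun p => dom kingGrid S (φ p)).sum ≤ 28) :
    57 ≤ (innerCells.map fun p => dom kingGrid S (φ p)).sum := by
  classical
  by_contra! hI
  have hcount : ∀ D ⊆ innerCells, (D.map fun p => dom kingGrid S (φ p)) =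
      D.map fun p => windowCells.countP fun x => near p x && decide (φ x ∈ S) := fun D hD =>
    List.map_congr_left fun p hp => (hφ.countP_near S (hD hp)).symm
  rw [hcount _ (List.subset_append_left _ _)] at hU
  rw [hcount _ (List.Subset.refl _)] at hI
  exact false_of_window (fun x => decide (φ x ∈ S))
    (fun p hp => hφ.three_le_countP_near hS hp) (fun e he => hφ.three_le_countP_separates hS he)
    hU (Nat.le_of_lt_succ hI)

theorem isWindowMap_translation (a b : ℤ) : IsWindowMap fun x => (a + x.1, b + x.2) where
  injOn := by
    rintro ⟨i, j⟩ - ⟨k, l⟩ - h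
    simp only [Prod.mk.injEq] at h ⊢
    omega
  near_iff := by
    rintro ⟨i, j⟩ - ⟨k, l⟩ -
    simp only [near, Bool.and_eq_true, Nat.ble_eq, mem_closedNbhd_kingGrid, abs_le]
    omega
  exists_of_mem := by
    rintro ⟨i, j⟩ hp ⟨d, e⟩ hd
    have := mem_innerCells hp
    simp only [mem_closedNbhd_kingGrid, abs_le] at hd
    refine ⟨((d - a).toNat, (e - b).toNat), mem_windowCells_iff.2 (by omega), ?_⟩
    simp only [Prod.mk.injEq]
    omega

theorem isWindowMap_reflection (a b : ℤ) : IsWindowMap fun x => (a - x.1, b + x.2) where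
  injOn := by
    rintro ⟨i, j⟩ - ⟨k, l⟩ - h
    simp only [Prod.mk.injEq] at h ⊢
    omega
  near_iff := by
    rintro ⟨i, j⟩ - ⟨k, l⟩ -
    simp only [near, Bool.and_eq_true, Nat.ble_eq, mem_closedNbhd_kingGrid, abs_le]
    omega
  exists_of_mem := by
    rintro ⟨i, j⟩ hp ⟨d, e⟩ hd
    have := mem_innerCells hp
    simp only [mem_closedNbhd_kingGrid, abs_le] at hd
    refine ⟨((a - d).toNat, (e - b).toNat), mem_windowCells_iff.2 (by omega), ?_⟩
    simp only [Prod.mk.injEq]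
    omega

/-- In every `4 × 4` block the domination counts add up to at least `57`. -/
theorem IsERRLD.le_sum_dom_block {S : Set (ℤ × ℤ)} (hS : IsERRLD kingGrid S) (a b : ℤ) :
    57 ≤ ∑ i ∈ Finset.range 4, ∑ j ∈ Finset.range 4, dom kingGrid S (a + i, b + j) := by
  -- Inner indices start at 1, hence the shifts. The reflection exchanges the two halves of the
  -- block, and one of them has at most 28 if the total is at most 56.
  have h1 := (isWindowMap_translation (a - 1) (b - 1)).block_bound hS
  have h2 := (isWindowMap_reflection (a + 4) (b - 1)).block_bound hS
  have e1 (i j : ℕ) : ((a - 1 + i, b - 1 + j) : ℤ × ℤ) = (a + (i - 1 : ℤ), b + (j - 1 : ℤ)) := by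
    ext <;> simp <;> ring
  have e2 (i j : ℕ) : ((a + 4 - i, b - 1 + j) : ℤ × ℤ) = (a + (4 - i : ℤ), b + (j - 1 : ℤ)) := by
    ext <;> simp <;> ring
  simp only [e1, e2] at h1 h2
  simp only [innerCells, upperCells, lowerCells, List.cons_append, List.nil_append, List.map_cons,
    List.map_nil, List.sum_cons, List.sum_nil] at h1 h2
  norm_num at h1 h2
  simp only [Finset.sum_range_succ, Finset.sum_range_zero]
  norm_num
  omega

/-! ### Density of detectors and sum of shares -/

theorem sum_range_four_mul {M : Type*} [AddCommMonoid M] (g : ℕ → M) (k : ℕ) :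
    ∑ i ∈ Finset.range (4 * k), g i =
      ∑ i ∈ Finset.range k, ∑ a ∈ Finset.range 4, g (4 * i + a) := by
  induction k with
  | zero => simp
  | succ k ih =>
    rw [Finset.sum_range_succ, ← ih, mul_add, mul_one, Finset.sum_range_add]

theorem IsERRLD.le_sum_dom_square {S : Set (ℤ × ℤ)} (hS : IsERRLD kingGrid S) (a b : ℤ) (k : ℕ) :
    57 * k ^ 2 ≤ ∑ i ∈ Finset.range (4 * k), ∑ j ∈ Finset.range (4 * k),
      dom kingGrid S (a + i, b + j) := by
  have hrow (i : ℕ) : ∑ p ∈ Finset.range 4, ∑ j ∈ Finset.range (4 * k),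
      dom kingGrid S (a + (4 * i + p : ℕ), b + j) = ∑ j ∈ Finset.range k,
        ∑ p ∈ Finset.range 4, ∑ q ∈ Finset.range 4,
          dom kingGrid S (a + 4 * i + p, b + 4 * j + q) := by
    rw [Finset.sum_comm (s := Finset.range k)]
    refine Finset.sum_congr rfl fun p _ => ?_
    rw [sum_range_four_mul]
    simp only [Nat.cast_add, Nat.cast_mul, Nat.cast_ofNat, add_assoc]
  rw [sum_range_four_mul, Finset.sum_congr rfl fun i _ => hrow i]
  calc 57 * k ^ 2 = ∑ i ∈ Finset.range k, ∑ j ∈ Finset.range k, 57 := by simp; ring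
    _ ≤ _ := Finset.sum_le_sum fun i _ => Finset.sum_le_sum fun j _ =>
      hS.le_sum_dom_block _ _

/-- The closed neighborhood in the king grid as a finite set. -/
noncomputable def kingNbhd (u : ℤ × ℤ) : Finset (ℤ × ℤ) :=
  Finset.Icc (u.1 - 1) (u.1 + 1) ×ˢ Finset.Icc (u.2 - 1) (u.2 + 1)

theorem mem_kingNbhd {u v : ℤ × ℤ} : v ∈ kingNbhd u ↔ |v.1 - u.1| ≤ 1 ∧ |v.2 - u.2| ≤ 1 := by
  simp only [kingNbhd, Finset.mem_product, Finset.mem_Icc, abs_le]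
  omega

theorem coe_kingNbhd (u : ℤ × ℤ) : (kingNbhd u : Set (ℤ × ℤ)) = closedNbhd kingGrid u := by
  ext v
  rw [Finset.mem_coe, mem_kingNbhd, mem_closedNbhd_kingGrid]

theorem mem_kingNbhd_comm {u v : ℤ × ℤ} : v ∈ kingNbhd u ↔ u ∈ kingNbhd v := by
  rw [mem_kingNbhd, mem_kingNbhd, abs_sub_comm, abs_sub_comm v.2]

theorem card_kingNbhd (u : ℤ × ℤ) : (kingNbhd u).card = 9 := by
  rw [kingNbhd, Finset.card_product, Int.card_Icc, Int.card_Icc]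
  have h (a : ℤ) : (a + 1 + 1 - (a - 1)).toNat = 3 := by omega
  rw [h, h]

open Classical in
theorem dom_kingGrid (S : Set (ℤ × ℤ)) (v : ℤ × ℤ) :
    dom kingGrid S v = ((kingNbhd v).filter (· ∈ S)).card := by
  rw [dom, ← Set.ncard_coe_finset]
  congr 1
  ext u
  simp only [Set.mem_ofPred_eq, Finset.coe_filter]
  rw [← coe_kingNbhd, Finset.mem_coe, mem_kingNbhd_comm, and_comm]

theorem share_kingGrid (S : Set (ℤ × ℤ)) (x : ℤ × ℤ) :
    share kingGrid S x = ∑ u ∈ kingNbhd x, partialShare kingGrid S u := by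
  rw [share, ← coe_kingNbhd, finsum_mem_coe_finset]

theorem mem_detectorsInSquare {S : Set (ℤ × ℤ)} {c x : ℤ × ℤ} {n : ℕ} :
    x ∈ detectorsInSquare S c n ↔
      ((c.1 - n ≤ x.1 ∧ x.1 ≤ c.1 + n) ∧ c.2 - n ≤ x.2 ∧ x.2 ≤ c.2 + n) ∧ x ∈ S := by
  simp [detectorsInSquare]

theorem sum_dom_le_nine_mul_card {S : Set (ℤ × ℤ)} {c : ℤ × ℤ} {n : ℕ} (U : Finset (ℤ × ℤ))
    (hU : ∀ u ∈ U, ∀ x ∈ kingNbhd u, x ∈ S → x ∈ detectorsInSquare S c n) :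
    ∑ u ∈ U, dom kingGrid S u ≤ 9 * (detectorsInSquare S c n).card := by
  classical
  calc ∑ u ∈ U, dom kingGrid S u
      ≤ ∑ u ∈ U, ((detectorsInSquare S c n).filter (u ∈ kingNbhd ·)).card := by
        refine Finset.sum_le_sum fun u hu => ?_
        rw [dom_kingGrid]
        refine Finset.card_le_card fun x hx => ?_
        rw [Finset.mem_filter] at hx ⊢
        exact ⟨hU u hu x hx.1 hx.2, mem_kingNbhd_comm.1 hx.1⟩
    _ = ∑ x ∈ detectorsInSquare S c n, (U.filter (· ∈ kingNbhd x)).card :=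
        Finset.sum_card_bipartiteAbove_eq_sum_card_bipartiteBelow fun u x => u ∈ kingNbhd x
    _ ≤ ∑ x ∈ detectorsInSquare S c n, 9 := by
        refine Finset.sum_le_sum fun x _ => ?_
        rw [← card_kingNbhd x]
        exact Finset.card_le_card fun u hu => (Finset.mem_filter.1 hu).2
    _ = 9 * (detectorsInSquare S c n).card := by simp [mul_comm]

theorem IsERRLD.le_card_detectorsInSquare {S : Set (ℤ × ℤ)} (hS : IsERRLD kingGrid S) (c : ℤ × ℤ)
    {n k : ℕ} (hk : 4 * k + 1 ≤ 2 * n) : 57 * k ^ 2 ≤ 9 * (detectorsInSquare S c n).card := by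
  -- Starting one step inside `Q_n`, the square of side `4k` keeps its closed neighborhoods within
  -- `Q_n`.
  have h := hS.le_sum_dom_square (c.1 - n + 1) (c.2 - n + 1) k
  rw [← Finset.sum_product'] at h
  have hinj : Set.InjOn (fun p : ℕ × ℕ => ((c.1 - n + 1 + p.1, c.2 - n + 1 + p.2) : ℤ × ℤ))
      (Finset.range (4 * k) ×ˢ Finset.range (4 * k) : Finset (ℕ × ℕ)) := by
    rintro ⟨i, j⟩ - ⟨i', j'⟩ - h
    simp only [Prod.mk.injEq] at h ⊢
    omega
  rw [← Finset.sum_image (f := dom kingGrid S) hinj] at h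
  refine h.trans (sum_dom_le_nine_mul_card _ fun u hu x hx hxS => ?_)
  obtain ⟨⟨i, j⟩, hp, rfl⟩ := Finset.mem_image.1 hu
  simp only [Finset.mem_product, Finset.mem_range] at hp
  simp only [mem_kingNbhd, abs_le] at hx
  refine mem_detectorsInSquare.2 ⟨?_, hxS⟩
  omega

theorem sum_share_le (S : Set (ℤ × ℤ)) (c : ℤ × ℤ) (n : ℕ) :
    ∑ x ∈ detectorsInSquare S c n, share kingGrid S x ≤ (2 * n + 3 : ℝ) ^ 2 := by
  classical
  set U : Finset (ℤ × ℤ) :=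
    Finset.Icc (c.1 - (n + 1)) (c.1 + (n + 1)) ×ˢ Finset.Icc (c.2 - (n + 1)) (c.2 + (n + 1))
    with hU
  have hcard : U.card = (2 * n + 3) ^ 2 := by
    rw [hU, Finset.card_product, Int.card_Icc, Int.card_Icc]
    have h (a : ℤ) : (a + (n + 1) + 1 - (a - (n + 1))).toNat = 2 * n + 3 := by omega
    rw [h, h, sq]
  have hsub : ∀ x ∈ detectorsInSquare S c n, kingNbhd x ⊆ U := by
    intro x hx u hu
    rw [mem_detectorsInSquare] at hx
    simp only [mem_kingNbhd, abs_le] at hu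
    simp only [hU, Finset.mem_product, Finset.mem_Icc]
    omega
  calc ∑ x ∈ detectorsInSquare S c n, share kingGrid S x
      = ∑ x ∈ detectorsInSquare S c n, ∑ u ∈ U,
          if u ∈ kingNbhd x then partialShare kingGrid S u else 0 := by
        refine Finset.sum_congr rfl fun x hx => ?_
        rw [share_kingGrid, ← Finset.sum_filter, Finset.filter_mem_eq_inter,
          Finset.inter_eq_right.2 (hsub x hx)]
    _ = ∑ u ∈ U, ∑ x ∈ detectorsInSquare S c n,
          if u ∈ kingNbhd x then partialShare kingGrid S u else 0 := Finset.sum_comm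
    _ ≤ ∑ u ∈ U, 1 := by
        refine Finset.sum_le_sum fun u _ => ?_
        rw [← Finset.sum_filter, Finset.sum_const, nsmul_eq_mul, partialShare, mul_one_div]
        -- Valid also for `dom u = 0`, where the quotient is 0.
        refine div_le_one_of_le₀ ?_ (Nat.cast_nonneg _)
        rw [dom_kingGrid]
        refine Nat.cast_le.2 (Finset.card_le_card fun x hx => ?_)
        rw [Finset.mem_filter] at hx ⊢
        exact ⟨mem_kingNbhd_comm.1 hx.2, (mem_detectorsInSquare.1 hx.1).2⟩
    _ = (2 * n + 3 : ℝ) ^ 2 := by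
        rw [Finset.sum_const, hcard]
        simp

theorem IsERRLD.squareAverageShare_le {S : Set (ℤ × ℤ)} (hS : IsERRLD kingGrid S) (c : ℤ × ℤ)
    {n : ℕ} (hn : 4000 ≤ n) : squareAverageShare S c n ≤ 38 / 15 := by
  obtain ⟨k, hk, hk'⟩ : ∃ k : ℕ, 4 * k + 1 ≤ 2 * n ∧ 2 * n ≤ 4 * k + 4 :=
    ⟨(2 * n - 1) / 4, by omega, by omega⟩
  have hcard := hS.le_card_detectorsInSquare c hk
  have hsum := sum_share_le S c n
  rw [squareAverageShare]
  refine div_le_of_le_mul₀ (Nat.cast_nonneg _) (by norm_num) (hsum.trans ?_)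
  have h1 : (57 * k ^ 2 : ℝ) ≤ 9 * (detectorsInSquare S c n).card := by exact_mod_cast hcard
  -- As `k ≥ (n - 2) / 2`, it suffices that `(2n+3)² ≤ (361/90)(n-2)²`. Since `361/90 > 4`, this
  -- holds for large `n`, and 4000 is ample.
  have h2 : (2 * n : ℝ) ≤ 4 * k + 4 := by exact_mod_cast hk'
  have h3 : (4000 : ℝ) ≤ n := by exact_mod_cast hn
  nlinarith

end LocatingDomination

theorem mainTheorem2 (S : Set (ℤ × ℤ)) (hS : LocatingDomination.IsERRLD kingGrid S) (c : ℤ × ℤ) :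
    LocatingDomination.averageShare S c ≤ (((38 : ℝ) / 15 : ℝ) : EReal) := by
  refine Filter.limsup_le_of_le (by isBoundedDefault) ?_
  filter_upwards [Filter.eventually_ge_atTop 4000] with n hn
  exact EReal.coe_le_coe_iff.2 (hS.squareAverageShare_le c hn)
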